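/- Let $X=[x^{(1)},\dots,x^{(n)}]^\top$ be a data matrix of $n$ points with $m\ge 1$ nonnegative features each, let every point have one of two class labels, and let $f_1,f_2\in\mathbb{R}_{\ge 0}^m$ be the sums of the feature vectors in class $1$ and class $2$. For an integer $s\ge 0$ let $\phi(s)$ be the optimal value of the $\ell_0$-constrained sparse multinomial naive Bayes problem $$\phi(s)=\max\Big\{ f_1^\top\log\theta_1+f_2^\top\log\theta_2 \;:\; \theta_1,\theta_2\in[0,1]^m,\ \mathbf 1^\top\theta_1=\mathbf 1^\top\theta_2=1,\ \|\theta_1-\theta_2\|_0\le s\Big\},$$ where $\|\cdot\|_0$ is the number of nonzero entries, $\log$ acts entrywise, $\log 0=-\infty$ and $0\log 0=0$. The maximum is attained. Let $$\psi(s)=\inf_{\mu_1,\mu_2>0}\ \mu_1+\mu_2+\mathbf 1^\top w+s_{m-s}(v-w),$$ where, with $\circ$ the entrywise product, $$v=(f_1+f_2)\circ\log\Big(\frac{f_1+f_2}{\mu_1+\mu_2}\Big)-(f_1+f_2),\qquad w=f_1\circ\log\Big(\frac{f_1}{\mu_1}\Big)+f_2\circ\log\Big(\frac{f_2}{\mu_2}\Big)-(f_1+f_2),$$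 and $s_{k}(z)$ is the sum of the $k$ largest entries of $z$ (with $s_{m-s}=0$ if $s\ge m$). This is a convex optimization problem in $(\mu_1,\mu_2)$: its objective is convex on $\{\mu_1,\mu_2>0\}$. Its infimum is attained if $f_1\ne0$ and $f_2\ne0$. For every $s\ge 0$, $$\phi(s)\le\psi(s),$$ and for every $s\ge 4$, $$\psi(s-4)\le\phi(s)\le\psi(s)\le\phi(s+4).$$ -/

import Mathlib

open scoped BigOperators

noncomputable section

namespace SparseMNB

/-- The sum `f_c` of the feature vectors `X j` of the data points whose class label is `c`. -/
def classSum {n m : ℕ} (X : Fin n → Fin m → ℝ) (Y : Fin n → Fin 2) (c : Fin 2) : Fin m → ℝ :=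
  fun i => ∑ j with Y j = c, X j i

/-- The training objective `f₁ᵀ log θ₁ + f₂ᵀ log θ₂`, with values in the extended reals:
`log 0 = -∞`, and `0 * log 0 = 0`. -/
def mnbLoss {m : ℕ} (f₁ f₂ θ₁ θ₂ : Fin m → ℝ) : EReal :=
  ∑ i, (f₁ i : EReal) * ENNReal.log (ENNReal.ofReal (θ₁ i)) +
    ∑ i, (f₂ i : EReal) * ENNReal.log (ENNReal.ofReal (θ₂ i))

/-- The feasible pairs `(θ₁, θ₂)` of the training problem with the constraint
`‖θ₁ - θ₂‖₀ ≤ s`. -/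
def feasible (m s : ℕ) : Set ((Fin m → ℝ) × (Fin m → ℝ)) :=
  {θ | (∀ i, θ.1 i ∈ Set.Icc (0 : ℝ) 1) ∧ (∀ i, θ.2 i ∈ Set.Icc (0 : ℝ) 1) ∧
    ∑ i, θ.1 i = 1 ∧ ∑ i, θ.2 i = 1 ∧ hammingNorm (θ.1 - θ.2) ≤ s}

/-- The optimal value of the sparse multinomial naive Bayes problem. -/
def phi {m : ℕ} (f₁ f₂ : Fin m → ℝ) (s : ℕ) : EReal :=
  ⨆ θ ∈ feasible m s, mnbLoss f₁ f₂ θ.1 θ.2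

/-- The sum of the `k` largest entries of `z` (for `k ≤ m`): the largest sum of `z` over `k`
distinct indices. -/
def topSum {m : ℕ} (k : ℕ) (z : Fin m → ℝ) : ℝ :=
  ⨆ S : {S : Finset (Fin m) // S.card = k}, ∑ i ∈ S.1, z i

/-- The vector `v = (f₁ + f₂) ∘ log ((f₁ + f₂) / (μ₁ + μ₂)) - (f₁ + f₂)`. -/
def vVec {m : ℕ} (f₁ f₂ : Fin m → ℝ) (μ : ℝ × ℝ) : Fin m → ℝ :=
  fun i => (f₁ i + f₂ i) * Real.log ((f₁ i + f₂ i) / (μ.1 + μ.2)) - (f₁ i + f₂ i)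

/-- The vector `w = f₁ ∘ log (f₁ / μ₁) + f₂ ∘ log (f₂ / μ₂) - (f₁ + f₂)`. -/
def wVec {m : ℕ} (f₁ f₂ : Fin m → ℝ) (μ : ℝ × ℝ) : Fin m → ℝ :=
  fun i => f₁ i * Real.log (f₁ i / μ.1) + f₂ i * Real.log (f₂ i / μ.2) - (f₁ i + f₂ i)

/-- The objective `μ₁ + μ₂ + 1ᵀ w + s_{m-s}(v - w)`. For `s ≥ m` the truncated difference `m - s`
is `0`, and no entry of `v - w` is counted. -/
def ubObjective {m : ℕ} (f₁ f₂ : Fin m → ℝ) (s : ℕ) (μ : ℝ × ℝ) : ℝ :=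
  μ.1 + μ.2 + ∑ i, wVec f₁ f₂ μ i + topSum (m - s) (vVec f₁ f₂ μ - wVec f₁ f₂ μ)

/-- The domain `μ₁ > 0`, `μ₂ > 0` of the upper-bound problem. -/
def ubDomain : Set (ℝ × ℝ) := {μ | 0 < μ.1 ∧ 0 < μ.2}

/-- The optimal value of the upper-bound problem. -/
def psi {m : ℕ} (f₁ f₂ : Fin m → ℝ) (s : ℕ) : EReal :=
  ⨅ μ ∈ ubDomain, (ubObjective f₁ f₂ s μ : EReal)

end SparseMNB

end

namespace SparseMNB

open Finset Set

/-! Multipliers `μ` for the two normalizations separate the problem over coordinates. By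
Fenchel–Young for the logarithm (`mul_log_le`), coordinate `i` contributes at most `w i` in general
and at most `v i` if its two parameters agree. A feasible pair agrees on at least `m - s`
coordinates, which gives weak duality (`mnbLoss_le_ubObjective`).

Conversely, the dual objective is the maximum of finitely many smooth convex functions, one for each
set `T` of `m - s` shared coordinates. At a minimizer a convex combination of the active gradients
vanishes (`exists_mem_convexHull_stationary`). Averaging the indicators of the active sets with
these weights gives a point of the unit cube subject to four linear equations: its sum, its pairing
with `v - w`, and two stationarity equations. An extreme point of the solution set has at most four
fractional entries (`exists_map_eq_card_fractional_le`). Used as weights between the shared and the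
separate optimal parameters, it gives vectors that sum to `1` by stationarity, differ in at most `s
+ 4` places, and lose nothing because `log` is concave (`ubObjective_le_phi_of_isMinOn`).

If a class sum vanishes, a dual minimizer need not exist, but then the equal-parameter and the
unconstrained optima coincide. -/

lemma classSum_nonneg {n m : ℕ} {X : Fin n → Fin m → ℝ} (hX : ∀ j i, 0 ≤ X j i)
    (Y : Fin n → Fin 2) (c : Fin 2) (i : Fin m) : 0 ≤ classSum X Y c i :=
  sum_nonneg fun j _ => hX j i

/-! ### The extended-real loss as a log-likelihood -/

/-- The likelihood whose logarithm is the training objective. -/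
noncomputable def likelihood {m : ℕ} (f₁ f₂ θ₁ θ₂ : Fin m → ℝ) : ℝ :=
  (∏ i, θ₁ i ^ f₁ i) * ∏ i, θ₂ i ^ f₂ i

/-- The convention `0 * log 0 = 0` corresponds to `0 ^ 0 = 1` for real powers. -/
lemma sum_mul_log_eq_log_prod {m : ℕ} {f θ : Fin m → ℝ} (hf : ∀ i, 0 ≤ f i) (hθ : ∀ i, 0 ≤ θ i) :
    ∑ i, (f i : EReal) * ENNReal.log (ENNReal.ofReal (θ i)) =
      ENNReal.log (ENNReal.ofReal (∏ i, θ i ^ f i)) := by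
  rw [ENNReal.ofReal_prod_of_nonneg fun i _ => Real.rpow_nonneg (hθ i) _]
  have key : ∀ s : Finset (Fin m), ∑ i ∈ s, (f i : EReal) * ENNReal.log (ENNReal.ofReal (θ i)) =
      ENNReal.log (∏ i ∈ s, ENNReal.ofReal (θ i ^ f i)) := by
    intro s
    induction s using Finset.cons_induction with
    | empty => simp
    | cons a s ha ih =>
      rw [sum_cons, prod_cons, ENNReal.log_mul_add, ih,
        ← ENNReal.ofReal_rpow_of_nonneg (hθ a) (hf a), ENNReal.log_rpow]
  exact key univ

lemma mnbLoss_eq_log_likelihood {m : ℕ} {f₁ f₂ θ₁ θ₂ : Fin m → ℝ} (hf₁ : ∀ i, 0 ≤ f₁ i)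
    (hf₂ : ∀ i, 0 ≤ f₂ i) (hθ₁ : ∀ i, 0 ≤ θ₁ i) (hθ₂ : ∀ i, 0 ≤ θ₂ i) :
    mnbLoss f₁ f₂ θ₁ θ₂ = ENNReal.log (ENNReal.ofReal (likelihood f₁ f₂ θ₁ θ₂)) := by
  rw [mnbLoss, sum_mul_log_eq_log_prod hf₁ hθ₁, sum_mul_log_eq_log_prod hf₂ hθ₂,
    ← ENNReal.log_mul_add, ← ENNReal.ofReal_mul
      (prod_nonneg fun i _ => Real.rpow_nonneg (hθ₁ i) _), likelihood]

lemma rpow_pos_of_eq_zero_or_pos {f θ : ℝ} (h : f = 0 ∨ 0 < θ) : 0 < θ ^ f := by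
  rcases h with rfl | h
  · simp
  · exact Real.rpow_pos_of_pos h f

lemma log_rpow_of_eq_zero_or_pos {f θ : ℝ} (h : f = 0 ∨ 0 < θ) :
    Real.log (θ ^ f) = f * Real.log θ := by
  rcases h with rfl | h
  · simp
  · exact Real.log_rpow h f

lemma mnbLoss_eq_coe {m : ℕ} {f₁ f₂ θ₁ θ₂ : Fin m → ℝ} (hf₁ : ∀ i, 0 ≤ f₁ i)
    (hf₂ : ∀ i, 0 ≤ f₂ i) (hθ₁ : ∀ i, 0 ≤ θ₁ i) (hθ₂ : ∀ i, 0 ≤ θ₂ i)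
    (h₁ : ∀ i, f₁ i = 0 ∨ 0 < θ₁ i) (h₂ : ∀ i, f₂ i = 0 ∨ 0 < θ₂ i) :
    mnbLoss f₁ f₂ θ₁ θ₂ =
      ((∑ i, (f₁ i * Real.log (θ₁ i) + f₂ i * Real.log (θ₂ i)) : ℝ) : EReal) := by
  have p₁ : 0 < ∏ i, θ₁ i ^ f₁ i := prod_pos fun i _ => rpow_pos_of_eq_zero_or_pos (h₁ i)
  have p₂ : 0 < ∏ i, θ₂ i ^ f₂ i := prod_pos fun i _ => rpow_pos_of_eq_zero_or_pos (h₂ i)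
  rw [mnbLoss_eq_log_likelihood hf₁ hf₂ hθ₁ hθ₂, likelihood,
    ENNReal.log_ofReal_of_pos (mul_pos p₁ p₂), Real.log_mul p₁.ne' p₂.ne',
    Real.log_prod fun i _ => (rpow_pos_of_eq_zero_or_pos (h₁ i)).ne',
    Real.log_prod fun i _ => (rpow_pos_of_eq_zero_or_pos (h₂ i)).ne', sum_add_distrib]
  simp only [fun i => log_rpow_of_eq_zero_or_pos (h₁ i), fun i => log_rpow_of_eq_zero_or_pos (h₂ i)]

lemma mnbLoss_eq_bot {m : ℕ} {f₁ f₂ θ₁ θ₂ : Fin m → ℝ} (hf₁ : ∀ i, 0 ≤ f₁ i)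
    (hf₂ : ∀ i, 0 ≤ f₂ i) (hθ₁ : ∀ i, 0 ≤ θ₁ i) (hθ₂ : ∀ i, 0 ≤ θ₂ i)
    (h : ¬ ((∀ i, f₁ i = 0 ∨ 0 < θ₁ i) ∧ ∀ i, f₂ i = 0 ∨ 0 < θ₂ i)) :
    mnbLoss f₁ f₂ θ₁ θ₂ = ⊥ := by
  have hp : likelihood f₁ f₂ θ₁ θ₂ = 0 := by
    rw [not_and_or] at h
    push Not at h
    rcases h with ⟨i, hi, hi'⟩ | ⟨i, hi, hi'⟩
    · refine mul_eq_zero_of_left (prod_eq_zero (mem_univ i) ?_) _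
      rw [le_antisymm hi' (hθ₁ i), Real.zero_rpow hi]
    · refine mul_eq_zero_of_right _ (prod_eq_zero (mem_univ i) ?_)
      rw [le_antisymm hi' (hθ₂ i), Real.zero_rpow hi]
  simp [mnbLoss_eq_log_likelihood hf₁ hf₂ hθ₁ hθ₂, hp]

/-! ### Compactness and attainment of the primal optimum -/

/-- The set is a finite union of linear subspaces, one for each set `D` of coordinates allowed to
differ. -/
lemma isClosed_hammingNorm_sub_le (m s : ℕ) :
    IsClosed {θ : (Fin m → ℝ) × (Fin m → ℝ) | hammingNorm (θ.1 - θ.2) ≤ s} := by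
  have : {θ : (Fin m → ℝ) × (Fin m → ℝ) | hammingNorm (θ.1 - θ.2) ≤ s} =
      ⋃ D ∈ {D : Finset (Fin m) | #D ≤ s}, {θ | ∀ i ∉ D, θ.1 i = θ.2 i} := by
    ext θ
    simp only [mem_ofPred_eq, mem_iUnion, exists_prop]
    constructor
    · intro h
      refine ⟨_, h, fun i hi => ?_⟩
      simpa [sub_eq_zero] using hi
    · rintro ⟨D, hD, h⟩
      refine (card_le_card fun i hi => ?_).trans hD
      by_contra hi'
      simp [h i hi'] at hi
  rw [this]
  refine (Set.toFinite _).isClosed_biUnion fun D _ => ?_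
  simp only [ofPred_forall]
  exact isClosed_iInter fun i => isClosed_iInter fun _ => isClosed_eq (by fun_prop) (by fun_prop)

lemma isCompact_feasible (m s : ℕ) : IsCompact (feasible m s) := by
  have hc : IsCompact ((univ.pi fun _ : Fin m => Icc (0 : ℝ) 1) ×ˢ
      (univ.pi fun _ : Fin m => Icc (0 : ℝ) 1)) :=
    (isCompact_univ_pi fun _ => isCompact_Icc).prod (isCompact_univ_pi fun _ => isCompact_Icc)
  have h₁ : IsClosed {θ : (Fin m → ℝ) × (Fin m → ℝ) | ∑ i, θ.1 i = 1} :=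
    isClosed_eq (by fun_prop) (by fun_prop)
  have h₂ : IsClosed {θ : (Fin m → ℝ) × (Fin m → ℝ) | ∑ i, θ.2 i = 1} :=
    isClosed_eq (by fun_prop) (by fun_prop)
  convert hc.inter_right (h₁.inter (h₂.inter (isClosed_hammingNorm_sub_le m s))) using 1
  ext θ
  simp [feasible, and_assoc, -pi_univ_Icc]

lemma mem_feasible_of_nonneg {m s : ℕ} {θ₁ θ₂ : Fin m → ℝ} (h₁ : ∀ i, 0 ≤ θ₁ i)
    (h₂ : ∀ i, 0 ≤ θ₂ i) (s₁ : ∑ i, θ₁ i = 1) (s₂ : ∑ i, θ₂ i = 1)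
    (hs : hammingNorm (θ₁ - θ₂) ≤ s) : (θ₁, θ₂) ∈ feasible m s :=
  ⟨fun i => ⟨h₁ i, s₁ ▸ single_le_sum (fun j _ => h₁ j) (mem_univ i)⟩,
    fun i => ⟨h₂ i, s₂ ▸ single_le_sum (fun j _ => h₂ j) (mem_univ i)⟩, s₁, s₂, hs⟩

lemma feasible_nonempty {m : ℕ} (hm : 1 ≤ m) (s : ℕ) : (feasible m s).Nonempty := by
  refine ⟨(Pi.single ⟨0, hm⟩ 1, Pi.single ⟨0, hm⟩ 1), mem_feasible_of_nonneg ?_ ?_ ?_ ?_ ?_⟩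
  · exact fun i => (Pi.single_nonneg.2 zero_le_one : (0 : Fin m → ℝ) ≤ _) i
  · exact fun i => (Pi.single_nonneg.2 zero_le_one : (0 : Fin m → ℝ) ≤ _) i
  · simp
  · simp
  · simp

/-- The loss can be `-∞`, but the likelihood is continuous for nonnegative exponents, and the
extended logarithm is monotone. -/
theorem exists_mnbLoss_eq_phi {m : ℕ} (hm : 1 ≤ m) {f₁ f₂ : Fin m → ℝ} (hf₁ : ∀ i, 0 ≤ f₁ i)
    (hf₂ : ∀ i, 0 ≤ f₂ i) (s : ℕ) :
    ∃ θ ∈ feasible m s, mnbLoss f₁ f₂ θ.1 θ.2 = phi f₁ f₂ s := by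
  have hcont : Continuous fun θ : (Fin m → ℝ) × (Fin m → ℝ) => likelihood f₁ f₂ θ.1 θ.2 := by
    unfold likelihood
    refine .mul (continuous_finsetProd _ fun i _ => ?_) (continuous_finsetProd _ fun i _ => ?_)
    · exact (Real.continuous_rpow_const (hf₁ i)).comp (by fun_prop)
    · exact (Real.continuous_rpow_const (hf₂ i)).comp (by fun_prop)
  obtain ⟨θ, hθ, hmax⟩ := (isCompact_feasible m s).exists_isMaxOn (feasible_nonempty hm s)
    hcont.continuousOn
  refine ⟨θ, hθ, le_antisymm (le_iSup₂_of_le θ hθ le_rfl) (iSup₂_le fun η hη => ?_)⟩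
  rw [mnbLoss_eq_log_likelihood hf₁ hf₂ (fun i => (hη.1 i).1) fun i => (hη.2.1 i).1,
    mnbLoss_eq_log_likelihood hf₁ hf₂ (fun i => (hθ.1 i).1) fun i => (hθ.2.1 i).1]
  exact ENNReal.log_monotone (ENNReal.ofReal_le_ofReal (hmax hη))

/-! ### Rounding in the unit cube -/

/-- A point of the unit cube can be moved along the fibre of a linear map of rank at most `k` to a
point of the cube with at most `k` fractional coordinates. -/
lemma exists_map_eq_card_fractional_le {ι W : Type*} [Fintype ι] [AddCommGroup W] [Module ℝ W]
    [FiniteDimensional ℝ W] (L : (ι → ℝ) →ₗ[ℝ] W) {x : ι → ℝ} (hx : ∀ i, x i ∈ Icc (0 : ℝ) 1) :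
    ∃ y : ι → ℝ, (∀ i, y i ∈ Icc (0 : ℝ) 1) ∧ L y = L x ∧
      #{i | 0 < y i ∧ y i < 1} ≤ Module.finrank ℝ W := by
  classical
  set Q : Set (ι → ℝ) := {y | (∀ i, y i ∈ Icc (0 : ℝ) 1) ∧ L y = L x} with hQ
  have hQc : IsCompact Q := by
    have hcl : IsClosed {y : ι → ℝ | L y = L x} := by
      have : {y : ι → ℝ | L y = L x} = (fun y => y - x) ⁻¹' (LinearMap.ker L : Set (ι → ℝ)) := by
        ext y
        simp [sub_eq_zero]
      rw [this]
      exact (Submodule.closed_of_finiteDimensional _).preimage (by fun_prop)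
    convert (isCompact_univ_pi fun _ : ι => isCompact_Icc (a := (0 : ℝ)) (b := 1)).inter_right hcl
      using 1
    ext y
    simp [hQ, -pi_univ_Icc]
  obtain ⟨y, hy⟩ := hQc.extremePoints_nonempty ⟨x, hx, rfl⟩
  obtain ⟨⟨hy01, hyL⟩, hext⟩ := mem_extremePoints.1 hy
  refine ⟨y, hy01, hyL, ?_⟩
  by_contra! hcard
  set S : Finset ι := {i | 0 < y i ∧ y i < 1} with hS
  -- More fractional coordinates than `finrank ℝ W` leave a nonzero kernel direction supported on
  -- them. Small moves both ways stay in `Q`, contradicting extremality.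
  obtain ⟨d, hdker, hd0⟩ : ∃ d : S → ℝ, L (Function.extend Subtype.val d 0) = 0 ∧ d ≠ 0 := by
    have := LinearMap.ker_ne_bot_of_finrank_lt
      (f := L ∘ₗ Function.ExtendByZero.linearMap ℝ (Subtype.val : S → ι)) (by simpa using hcard)
    obtain ⟨d, hd, hd0⟩ := Submodule.exists_mem_ne_zero_of_ne_bot this
    exact ⟨d, hd, hd0⟩
  set e : ι → ℝ := Function.extend Subtype.val d 0 with he
  have heS : ∀ i ∉ S, e i = 0 := fun i hi =>
    Function.extend_apply' _ _ _ (by rintro ⟨a, rfl⟩; exact hi a.2)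
  have he0 : e ≠ 0 := fun h => hd0 <| by
    ext a
    rw [← Subtype.val_injective.extend_apply d 0 a]
    exact congrFun h a
  have hev : ∀ᶠ t : ℝ in nhdsWithin 0 (Ioi 0), ∀ i, y i + t * e i ∈ Icc (0 : ℝ) 1 ∧
      y i - t * e i ∈ Icc (0 : ℝ) 1 := by
    rw [Filter.eventually_all]
    intro i
    by_cases hi : i ∈ S
    · have hi' : 0 < y i ∧ y i < 1 := by simpa [hS] using hi
      have hn : Icc (0 : ℝ) 1 ∈ nhds (y i) := Icc_mem_nhds hi'.1 hi'.2
      refine nhdsWithin_le_nhds (Filter.Eventually.and ?_ ?_)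
      · have : Filter.Tendsto (fun t : ℝ => y i + t * e i) (nhds 0) (nhds (y i)) := by
          simpa using (by fun_prop : Continuous fun t : ℝ => y i + t * e i).tendsto 0
        exact this hn
      · have : Filter.Tendsto (fun t : ℝ => y i - t * e i) (nhds 0) (nhds (y i)) := by
          simpa using (by fun_prop : Continuous fun t : ℝ => y i - t * e i).tendsto 0
        exact this hn
    · simp [heS i hi, (hy01 i).1, (hy01 i).2]
  obtain ⟨t, ht, ht0⟩ := (hev.and self_mem_nhdsWithin).exists
  have hLe : L e = 0 := hdker
  have key := (hext (y + t • e) ⟨fun i => (ht i).1, by simp [hLe, hyL]⟩ (y - t • e)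
    ⟨fun i => (ht i).2, by simp [hLe, hyL]⟩
    ⟨1 / 2, 1 / 2, by norm_num, by norm_num, by norm_num, by module⟩).1
  have : t • e = 0 := by simpa using key
  rcases smul_eq_zero.1 this with h | h
  · exact (ne_of_gt ht0) h
  · exact he0 h

/-! ### Fenchel–Young and the dual objective -/

/-- This is `log t ≤ t - 1` at `t = θ * μ / f`, with equality at `θ = f / μ`. -/
lemma mul_log_le {f θ μ : ℝ} (hf : 0 ≤ f) (hθ : 0 ≤ θ) (h : f = 0 ∨ 0 < θ) (hμ : 0 < μ) :
    f * Real.log θ ≤ f * Real.log (f / μ) - f + μ * θ := by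
  rcases hf.eq_or_lt with rfl | hf
  · simpa using mul_nonneg hμ.le hθ
  · have hθ' : 0 < θ := h.resolve_left hf.ne'
    have h₁ := Real.log_le_sub_one_of_pos (show 0 < θ / (f / μ) by positivity)
    rw [Real.log_div hθ'.ne' (by positivity)] at h₁
    have h₂ := mul_le_mul_of_nonneg_left h₁ hf.le
    have h₃ : f * (θ / (f / μ) - 1) = μ * θ - f := by field_simp
    linarith

lemma mul_log_div {f μ : ℝ} (hμ : 0 < μ) :
    f * Real.log (f / μ) = f * Real.log f - f * Real.log μ := by
  rcases eq_or_ne f 0 with rfl | hf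
  · simp
  · rw [Real.log_div hf hμ.ne', mul_sub]

section

variable {m : ℕ} {f₁ f₂ : Fin m → ℝ}

/-- Forcing equal parameters cannot raise the coordinatewise supremum: the shared optimum `(f₁ i +
f₂ i) / (μ.1 + μ.2)` competes in the problem defining `w`. -/
lemma vVec_le_wVec (hf₁ : ∀ i, 0 ≤ f₁ i) (hf₂ : ∀ i, 0 ≤ f₂ i) {μ : ℝ × ℝ} (hμ : μ ∈ ubDomain)
    (i : Fin m) : vVec f₁ f₂ μ i ≤ wVec f₁ f₂ μ i := by
  obtain ⟨hμ₁, hμ₂⟩ := hμ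
  have hM : 0 < μ.1 + μ.2 := add_pos hμ₁ hμ₂
  set θ := (f₁ i + f₂ i) / (μ.1 + μ.2) with hθ
  have hθ0 : 0 ≤ θ := div_nonneg (add_nonneg (hf₁ i) (hf₂ i)) hM.le
  have hpos : 0 < f₁ i + f₂ i → 0 < θ := fun h => div_pos h hM
  have h₁ := mul_log_le (hf₁ i) hθ0
    ((hf₁ i).eq_or_lt.imp Eq.symm fun h => hpos (by linarith [hf₂ i])) hμ₁
  have h₂ := mul_log_le (hf₂ i) hθ0
    ((hf₂ i).eq_or_lt.imp Eq.symm fun h => hpos (by linarith [hf₁ i])) hμ₂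
  have h₃ : (μ.1 + μ.2) * θ = f₁ i + f₂ i := mul_div_cancel₀ _ hM.ne'
  rw [vVec, wVec, ← hθ]
  linarith

/-- The upper-bound objective in which the two classes share their parameters exactly on `T`. -/
noncomputable def subsetObjective (f₁ f₂ : Fin m → ℝ) (T : Finset (Fin m)) (μ : ℝ × ℝ) : ℝ :=
  μ.1 + μ.2 + ∑ i, wVec f₁ f₂ μ i + ∑ i ∈ T, (vVec f₁ f₂ μ - wVec f₁ f₂ μ) i

instance (m s : ℕ) : Nonempty {S : Finset (Fin m) // #S = m - s} :=
  let ⟨T, _, hT⟩ := exists_subset_card_eq (s := (Finset.univ : Finset (Fin m))) (n := m - s)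
    (by simp)
  ⟨⟨T, hT⟩⟩

lemma sum_le_topSum {k : ℕ} {T : Finset (Fin m)} (hT : #T = k) (z : Fin m → ℝ) :
    ∑ i ∈ T, z i ≤ topSum k z :=
  le_ciSup (f := fun S : {S : Finset (Fin m) // #S = k} => ∑ i ∈ S.1, z i)
    (Set.finite_range _).bddAbove ⟨T, hT⟩

lemma exists_sum_eq_topSum (s : ℕ) (z : Fin m → ℝ) :
    ∃ T : Finset (Fin m), #T = m - s ∧ ∑ i ∈ T, z i = topSum (m - s) z := by
  obtain ⟨T, hT⟩ := exists_eq_ciSup_of_finite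
    (f := fun S : {S : Finset (Fin m) // #S = m - s} => ∑ i ∈ S.1, z i)
  exact ⟨T.1, T.2, hT⟩

lemma subsetObjective_le_ubObjective {s : ℕ} {T : Finset (Fin m)} (hT : #T = m - s) (μ : ℝ × ℝ) :
    subsetObjective f₁ f₂ T μ ≤ ubObjective f₁ f₂ s μ :=
  add_le_add_right (sum_le_topSum hT _) _

lemma exists_subsetObjective_eq (f₁ f₂ : Fin m → ℝ) (s : ℕ) (μ : ℝ × ℝ) :
    ∃ T : Finset (Fin m), #T = m - s ∧ subsetObjective f₁ f₂ T μ = ubObjective f₁ f₂ s μ := by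
  obtain ⟨T, hT, h⟩ := exists_sum_eq_topSum s (vVec f₁ f₂ μ - wVec f₁ f₂ μ)
  exact ⟨T, hT, by rw [subsetObjective, h, ubObjective]⟩

/-- The part of `subsetObjective` that does not depend on `μ`. -/
noncomputable def subsetConst (f₁ f₂ : Fin m → ℝ) (T : Finset (Fin m)) : ℝ :=
  ∑ i ∈ Tᶜ, (f₁ i * Real.log (f₁ i) + f₂ i * Real.log (f₂ i)) +
    ∑ i ∈ T, (f₁ i + f₂ i) * Real.log (f₁ i + f₂ i) - ∑ i, (f₁ i + f₂ i)

/-- In this log-barrier form convexity, growth and derivatives in `μ` can be read off. -/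
lemma subsetObjective_eq (T : Finset (Fin m)) {μ : ℝ × ℝ} (hμ : μ ∈ ubDomain) :
    subsetObjective f₁ f₂ T μ = μ.1 + μ.2 + subsetConst f₁ f₂ T -
      (∑ i ∈ Tᶜ, f₁ i) * Real.log μ.1 - (∑ i ∈ Tᶜ, f₂ i) * Real.log μ.2 -
      (∑ i ∈ T, (f₁ i + f₂ i)) * Real.log (μ.1 + μ.2) := by
  have hM : 0 < μ.1 + μ.2 := add_pos hμ.1 hμ.2
  have hw : ∀ i, wVec f₁ f₂ μ i = (f₁ i * Real.log (f₁ i) + f₂ i * Real.log (f₂ i)) -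
      (f₁ i + f₂ i) - f₁ i * Real.log μ.1 - f₂ i * Real.log μ.2 := fun i => by
    rw [wVec, mul_log_div hμ.1, mul_log_div hμ.2]; ring
  have hv : ∀ i, vVec f₁ f₂ μ i = (f₁ i + f₂ i) * Real.log (f₁ i + f₂ i) -
      (f₁ i + f₂ i) - (f₁ i + f₂ i) * Real.log (μ.1 + μ.2) := fun i => by
    rw [vVec, mul_log_div hM]; ring
  simp only [subsetObjective, subsetConst, Pi.sub_apply, sum_sub_distrib]
  rw [← sum_add_sum_compl T fun i => wVec f₁ f₂ μ i, ← sum_add_sum_compl T fun i => f₁ i + f₂ i]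
  simp only [hw, hv, sum_sub_distrib, ← sum_mul]
  ring

lemma convex_ubDomain : Convex ℝ ubDomain :=
  (convex_Ioi (0 : ℝ)).prod (convex_Ioi (0 : ℝ))

lemma concaveOn_log_linear (L : ℝ × ℝ →ₗ[ℝ] ℝ) (hL : ∀ μ ∈ ubDomain, 0 < L μ) :
    ConcaveOn ℝ ubDomain fun μ => Real.log (L μ) :=
  (strictConcaveOn_log_Ioi.concaveOn.comp_linearMap L).subset hL convex_ubDomain

lemma convexOn_subsetObjective (hf₁ : ∀ i, 0 ≤ f₁ i) (hf₂ : ∀ i, 0 ≤ f₂ i) (T : Finset (Fin m)) :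
    ConvexOn ℝ ubDomain (subsetObjective f₁ f₂ T) := by
  have c₁ : ConcaveOn ℝ ubDomain fun μ : ℝ × ℝ => (∑ i ∈ Tᶜ, f₁ i) * Real.log μ.1 :=
    (concaveOn_log_linear (LinearMap.fst ℝ ℝ ℝ) fun μ hμ => hμ.1).smul (sum_nonneg fun i _ => hf₁ i)
  have c₂ : ConcaveOn ℝ ubDomain fun μ : ℝ × ℝ => (∑ i ∈ Tᶜ, f₂ i) * Real.log μ.2 :=
    (concaveOn_log_linear (LinearMap.snd ℝ ℝ ℝ) fun μ hμ => hμ.2).smul (sum_nonneg fun i _ => hf₂ i)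
  have c₃ : ConcaveOn ℝ ubDomain
      fun μ : ℝ × ℝ => (∑ i ∈ T, (f₁ i + f₂ i)) * Real.log (μ.1 + μ.2) :=
    (concaveOn_log_linear (LinearMap.fst ℝ ℝ ℝ + LinearMap.snd ℝ ℝ ℝ)
      fun μ hμ => add_pos hμ.1 hμ.2).smul (sum_nonneg fun i _ => add_nonneg (hf₁ i) (hf₂ i))
  have c₀ : ConvexOn ℝ ubDomain fun μ : ℝ × ℝ => μ.1 + μ.2 + subsetConst f₁ f₂ T :=
    ((LinearMap.fst ℝ ℝ ℝ + LinearMap.snd ℝ ℝ ℝ).convexOn convex_ubDomain).add_const _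
  exact (((c₀.sub c₁).sub c₂).sub c₃).congr fun μ hμ => (subsetObjective_eq T hμ).symm

/-- A maximum of convex functions: a set `T` active at the combination gives the inequality. -/
theorem convexOn_ubObjective (hf₁ : ∀ i, 0 ≤ f₁ i) (hf₂ : ∀ i, 0 ≤ f₂ i) (s : ℕ) :
    ConvexOn ℝ ubDomain (ubObjective f₁ f₂ s) := by
  refine ⟨convex_ubDomain, fun x hx y hy a b ha hb hab => ?_⟩
  obtain ⟨T, hT, h⟩ := exists_subsetObjective_eq f₁ f₂ s (a • x + b • y)
  rw [← h]
  refine ((convexOn_subsetObjective hf₁ hf₂ T).2 hx hy ha hb hab).trans ?_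
  exact add_le_add (mul_le_mul_of_nonneg_left (subsetObjective_le_ubObjective hT x) ha)
    (mul_le_mul_of_nonneg_left (subsetObjective_le_ubObjective hT y) hb)

lemma isOpen_ubDomain : IsOpen ubDomain :=
  (isOpen_Ioi (a := (0 : ℝ))).prod (isOpen_Ioi (a := (0 : ℝ)))

/-! ### Weak duality -/

/-- Weak duality. -/
theorem mnbLoss_le_ubObjective (hf₁ : ∀ i, 0 ≤ f₁ i) (hf₂ : ∀ i, 0 ≤ f₂ i) {s : ℕ}
    {θ : (Fin m → ℝ) × (Fin m → ℝ)} (hθ : θ ∈ feasible m s) {μ : ℝ × ℝ} (hμ : μ ∈ ubDomain) :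
    mnbLoss f₁ f₂ θ.1 θ.2 ≤ (ubObjective f₁ f₂ s μ : EReal) := by
  obtain ⟨h₁, h₂, s₁, s₂, hs⟩ := hθ
  by_cases hpos : (∀ i, f₁ i = 0 ∨ 0 < θ.1 i) ∧ ∀ i, f₂ i = 0 ∨ 0 < θ.2 i
  swap
  · simp [mnbLoss_eq_bot hf₁ hf₂ (fun i => (h₁ i).1) (fun i => (h₂ i).1) hpos]
  obtain ⟨p₁, p₂⟩ := hpos
  rw [mnbLoss_eq_coe hf₁ hf₂ (fun i => (h₁ i).1) (fun i => (h₂ i).1) p₁ p₂, EReal.coe_le_coe_iff]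
  have hM : 0 < μ.1 + μ.2 := add_pos hμ.1 hμ.2
  -- At most `s` coordinates differ, so `m - s` shared ones can be selected.
  obtain ⟨T, hTsub, hT⟩ : ∃ T ⊆ ({i | (θ.1 - θ.2) i ≠ 0} : Finset (Fin m))ᶜ, #T = m - s :=
    exists_subset_card_eq (by rw [card_compl, Fintype.card_fin]; exact Nat.sub_le_sub_left hs m)
  refine le_trans ?_ (subsetObjective_le_ubObjective hT μ)
  have hterm : ∀ i, f₁ i * Real.log (θ.1 i) + f₂ i * Real.log (θ.2 i) ≤
      wVec f₁ f₂ μ i + (if i ∈ T then (vVec f₁ f₂ μ - wVec f₁ f₂ μ) i else 0) +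
        (μ.1 * θ.1 i + μ.2 * θ.2 i) := by
    intro i
    split_ifs with hi
    · have heq : θ.1 i = θ.2 i := by simpa [sub_eq_zero] using hTsub hi
      have h := mul_log_le (add_nonneg (hf₁ i) (hf₂ i)) (h₁ i).1 (by
        rcases p₁ i with h | h
        · rcases p₂ i with h' | h'
          · exact Or.inl (by rw [h, h', add_zero])
          · exact Or.inr (heq ▸ h')
        · exact Or.inr h) hM
      rw [← heq, Pi.sub_apply, vVec]
      linarith
    · have e₁ := mul_log_le (hf₁ i) (h₁ i).1 (p₁ i) hμ.1
      have e₂ := mul_log_le (hf₂ i) (h₂ i).1 (p₂ i) hμ.2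
      rw [wVec]
      linarith
  refine (sum_le_sum fun i _ => hterm i).trans_eq ?_
  rw [sum_add_distrib, sum_add_distrib, sum_add_distrib, ← mul_sum, ← mul_sum, s₁, s₂,
    sum_ite_mem, Finset.univ_inter, subsetObjective]
  ring

theorem phi_le_psi (hf₁ : ∀ i, 0 ≤ f₁ i) (hf₂ : ∀ i, 0 ≤ f₂ i) (s : ℕ) :
    phi f₁ f₂ s ≤ psi f₁ f₂ s :=
  iSup₂_le fun _ hθ => le_iInf₂ fun _ hμ => mnbLoss_le_ubObjective hf₁ hf₂ hθ hμ

/-! ### Attainment of the dual optimum -/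

lemma exists_pos_of_ne_zero {f : Fin m → ℝ} (hf : ∀ i, 0 ≤ f i) (h : f ≠ 0) : ∃ i, 0 < f i := by
  obtain ⟨i, hi⟩ := Function.ne_iff.1 h
  exact ⟨i, (hf i).lt_of_ne' hi⟩

lemma subsetObjective_ge (hf₁ : ∀ i, 0 ≤ f₁ i) (hf₂ : ∀ i, 0 ≤ f₂ i) (T : Finset (Fin m))
    {μ : ℝ × ℝ} (hμ : μ ∈ ubDomain) :
    (μ.1 + μ.2) / 2 + (subsetConst f₁ f₂ T + ∑ i, (f₁ i + f₂ i) -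
      (∑ i, (f₁ i + f₂ i)) * Real.log ((∑ i, (f₁ i + f₂ i)) / (1 / 2))) ≤
        subsetObjective f₁ f₂ T μ := by
  have hM : 0 < μ.1 + μ.2 := add_pos hμ.1 hμ.2
  have ha : 0 ≤ ∑ i ∈ Tᶜ, f₁ i := sum_nonneg fun i _ => hf₁ i
  have hb : 0 ≤ ∑ i ∈ Tᶜ, f₂ i := sum_nonneg fun i _ => hf₂ i
  have hF : 0 ≤ ∑ i, (f₁ i + f₂ i) := sum_nonneg fun i _ => add_nonneg (hf₁ i) (hf₂ i)
  have hsum : ∑ i ∈ Tᶜ, f₁ i + ∑ i ∈ Tᶜ, f₂ i + ∑ i ∈ T, (f₁ i + f₂ i) = ∑ i, (f₁ i + f₂ i) := by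
    rw [← sum_add_distrib, add_comm, sum_add_sum_compl]
  have h₁ := mul_le_mul_of_nonneg_left
    (Real.log_le_log hμ.1 (le_add_of_nonneg_right hμ.2.le)) ha
  have h₂ := mul_le_mul_of_nonneg_left
    (Real.log_le_log hμ.2 (le_add_of_nonneg_left hμ.1.le)) hb
  -- The slope `1 / 2` spends only half of the linear term `μ.1 + μ.2`, and the other half gives
  -- coercivity.
  have h₃ := mul_log_le hF hM.le (.inr hM) (show (0 : ℝ) < 1 / 2 by norm_num)
  have h₄ : (∑ i, (f₁ i + f₂ i)) * Real.log (μ.1 + μ.2) =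
      (∑ i ∈ Tᶜ, f₁ i) * Real.log (μ.1 + μ.2) + (∑ i ∈ Tᶜ, f₂ i) * Real.log (μ.1 + μ.2) +
        (∑ i ∈ T, (f₁ i + f₂ i)) * Real.log (μ.1 + μ.2) := by
    rw [← hsum]; ring
  rw [subsetObjective_eq T hμ]
  linarith

/-- The barrier `-a * log x` keeps `x` away from `0`, since the other logarithms are at most `B`. -/
lemma exp_le_of_logBarrier_le {a b c K x y B r : ℝ} (ha : 0 < a) (hb : 0 ≤ b) (hc : 0 ≤ c)
    (hx : 0 < x) (hy : 0 < y) (hB : x + y ≤ B)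
    (h : x + y + K - a * Real.log x - b * Real.log y - c * Real.log (x + y) ≤ r) :
    Real.exp ((K - r - (b + c) * B) / a) ≤ x := by
  have h₁ := mul_le_mul_of_nonneg_left
    ((Real.log_le_sub_one_of_pos hy).trans (show y - 1 ≤ B by linarith)) hb
  have h₂ := mul_le_mul_of_nonneg_left
    ((Real.log_le_sub_one_of_pos (add_pos hx hy)).trans (show x + y - 1 ≤ B by linarith)) hc
  rw [← Real.le_log_iff_exp_le hx, div_le_iff₀ ha]
  linarith

lemma exists_card_eq_notMem {s : ℕ} (hs : 1 ≤ s) (i : Fin m) :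
    ∃ T : Finset (Fin m), #T = m - s ∧ i ∈ Tᶜ := by
  obtain ⟨T, hT, hc⟩ := Finset.exists_subset_card_eq (s := ({i}ᶜ : Finset (Fin m))) (n := m - s) (by
    rw [card_compl, Fintype.card_fin, Finset.card_singleton]; omega)
  refine ⟨T, hc, ?_⟩
  rw [Finset.mem_compl]
  intro hi
  simpa using hT hi

/-- As `s ≥ 1`, for each class some admissible `T` misses a coordinate where that class sum is
positive, so a barrier in each multiplier is active. The sublevel set through `(1, 1)` then lies in
a compact box inside the domain. -/
theorem exists_isMinOn_ubObjective_of_pos (hf₁ : ∀ i, 0 ≤ f₁ i) (hf₂ : ∀ i, 0 ≤ f₂ i)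
    (h₁ : f₁ ≠ 0) (h₂ : f₂ ≠ 0) {s : ℕ} (hs : 1 ≤ s) :
    ∃ μ ∈ ubDomain, IsMinOn (ubObjective f₁ f₂ s) ubDomain μ := by
  obtain ⟨i₁, hi₁⟩ := exists_pos_of_ne_zero hf₁ h₁
  obtain ⟨i₂, hi₂⟩ := exists_pos_of_ne_zero hf₂ h₂
  obtain ⟨T₁, hT₁, hiT₁⟩ := exists_card_eq_notMem hs i₁
  obtain ⟨T₂, hT₂, hiT₂⟩ := exists_card_eq_notMem hs i₂
  set r := ubObjective f₁ f₂ s (1, 1)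
  have hone : ((1, 1) : ℝ × ℝ) ∈ ubDomain := ⟨one_pos, one_pos⟩
  obtain ⟨B, hB⟩ : ∃ B, ∀ μ ∈ ubDomain, ubObjective f₁ f₂ s μ ≤ r → μ.1 + μ.2 ≤ B := by
    refine ⟨2 * (r - (subsetConst f₁ f₂ T₁ + ∑ i, (f₁ i + f₂ i) -
      (∑ i, (f₁ i + f₂ i)) * Real.log ((∑ i, (f₁ i + f₂ i)) / (1 / 2)))), fun μ hμ h => ?_⟩
    have := subsetObjective_ge hf₁ hf₂ T₁ hμ
    have := subsetObjective_le_ubObjective (f₁ := f₁) (f₂ := f₂) hT₁ μ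
    linarith
  obtain ⟨δ₁, hδ₁, hl₁⟩ : ∃ δ > 0, ∀ μ ∈ ubDomain, ubObjective f₁ f₂ s μ ≤ r → δ ≤ μ.1 := by
    refine ⟨_, Real.exp_pos _, fun μ hμ h => exp_le_of_logBarrier_le
      (sum_pos' (fun i _ => hf₁ i) ⟨i₁, hiT₁, hi₁⟩) (sum_nonneg fun i _ => hf₂ i)
      (sum_nonneg fun i _ => add_nonneg (hf₁ i) (hf₂ i)) hμ.1 hμ.2 (hB μ hμ h)
      (a := ∑ i ∈ T₁ᶜ, f₁ i) (b := ∑ i ∈ T₁ᶜ, f₂ i) (c := ∑ i ∈ T₁, (f₁ i + f₂ i))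
      (K := subsetConst f₁ f₂ T₁) (r := r) ?_⟩
    rw [← subsetObjective_eq T₁ hμ]
    exact (subsetObjective_le_ubObjective hT₁ μ).trans h
  obtain ⟨δ₂, hδ₂, hl₂⟩ : ∃ δ > 0, ∀ μ ∈ ubDomain, ubObjective f₁ f₂ s μ ≤ r → δ ≤ μ.2 := by
    refine ⟨_, Real.exp_pos _, fun μ hμ h => exp_le_of_logBarrier_le
      (sum_pos' (fun i _ => hf₂ i) ⟨i₂, hiT₂, hi₂⟩) (sum_nonneg fun i _ => hf₁ i)
      (sum_nonneg fun i _ => add_nonneg (hf₁ i) (hf₂ i)) hμ.2 hμ.1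
      ((add_comm _ _).trans_le (hB μ hμ h)) (a := ∑ i ∈ T₂ᶜ, f₂ i) (b := ∑ i ∈ T₂ᶜ, f₁ i)
      (c := ∑ i ∈ T₂, (f₁ i + f₂ i)) (K := subsetConst f₁ f₂ T₂) (r := r) ?_⟩
    refine le_trans (le_of_eq ?_) ((subsetObjective_le_ubObjective hT₂ μ).trans h)
    rw [subsetObjective_eq T₂ hμ, add_comm μ.2 μ.1]
    ring
  have hbox : ∀ μ ∈ ubDomain, ubObjective f₁ f₂ s μ ≤ r → μ ∈ Icc δ₁ B ×ˢ Icc δ₂ B :=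
    fun μ hμ h => ⟨⟨hl₁ μ hμ h, by linarith [hB μ hμ h, hμ.2]⟩,
      ⟨hl₂ μ hμ h, by linarith [hB μ hμ h, hμ.1]⟩⟩
  have hsub : Icc δ₁ B ×ˢ Icc δ₂ B ⊆ ubDomain := fun μ hμ =>
    ⟨hδ₁.trans_le hμ.1.1, hδ₂.trans_le hμ.2.1⟩
  have hcont := (convexOn_ubObjective hf₁ hf₂ s).continuousOn isOpen_ubDomain
  obtain ⟨μ, hμ, hmin⟩ := (isCompact_Icc.prod isCompact_Icc).exists_isMinOn
    ⟨_, hbox _ hone le_rfl⟩ (hcont.mono hsub)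
  refine ⟨μ, hsub hμ, fun ν hν => ?_⟩
  rcases le_total (ubObjective f₁ f₂ s ν) r with h | h
  · exact hmin (hbox ν hν h)
  · exact (hmin (hbox _ hone le_rfl)).trans h

/-- The optimal value with equal parameters is a lower bound for every sparsity level. -/
lemma coe_sum_le_phi (hm : 1 ≤ m) (hf₁ : ∀ i, 0 ≤ f₁ i) (hf₂ : ∀ i, 0 ≤ f₂ i) (s : ℕ) :
    ((∑ i, (f₁ i + f₂ i) * Real.log ((f₁ i + f₂ i) / ∑ j, (f₁ j + f₂ j)) : ℝ) : EReal) ≤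
      phi f₁ f₂ s := by
  have hf : ∀ i, 0 ≤ f₁ i + f₂ i := fun i => add_nonneg (hf₁ i) (hf₂ i)
  suffices h : ∃ θ : Fin m → ℝ, (∀ i, 0 ≤ θ i) ∧ ∑ i, θ i = 1 ∧
      (∀ i, f₁ i + f₂ i = 0 ∨ 0 < θ i) ∧
      ∀ i, (f₁ i + f₂ i) * Real.log ((f₁ i + f₂ i) / ∑ j, (f₁ j + f₂ j)) =
        (f₁ i + f₂ i) * Real.log (θ i) by
    obtain ⟨θ, h0, h1, hpos, heq⟩ := h
    have hfeas : (θ, θ) ∈ feasible m s := mem_feasible_of_nonneg h0 h0 h1 h1 (by simp)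
    refine le_iSup₂_of_le (θ, θ) hfeas (le_of_eq ?_)
    rw [mnbLoss_eq_coe hf₁ hf₂ h0 h0
      (fun i => (hpos i).imp_left fun h => le_antisymm (by linarith [hf₂ i]) (hf₁ i))
      (fun i => (hpos i).imp_left fun h => le_antisymm (by linarith [hf₁ i]) (hf₂ i))]
    simp only [heq, add_mul]
  rcases (sum_nonneg fun i _ => hf i : 0 ≤ ∑ j, (f₁ j + f₂ j)).eq_or_lt with h | h
  -- With zero total mass any probability vector will do; `hm` supplies one.
  · have hz : ∀ i, f₁ i + f₂ i = 0 := fun i =>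
      (sum_eq_zero_iff_of_nonneg fun i _ => hf i).1 h.symm i (mem_univ i)
    refine ⟨Pi.single ⟨0, hm⟩ 1, fun i => (Pi.single_nonneg.2 zero_le_one : (0 : Fin m → ℝ) ≤ _) i,
      by simp, fun i => .inl (hz i), fun i => by simp [hz i]⟩
  · exact ⟨fun i => (f₁ i + f₂ i) / ∑ j, (f₁ j + f₂ j), fun i => div_nonneg (hf i) h.le,
      by rw [← sum_div, div_self h.ne'],
      fun i => (hf i).eq_or_lt.imp Eq.symm fun h' => div_pos h' h, fun i => rfl⟩

theorem exists_isMinOn_ubObjective (hm : 1 ≤ m) (hf₁ : ∀ i, 0 ≤ f₁ i) (hf₂ : ∀ i, 0 ≤ f₂ i)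
    (h₁ : f₁ ≠ 0) (h₂ : f₂ ≠ 0) (s : ℕ) :
    ∃ μ ∈ ubDomain, IsMinOn (ubObjective f₁ f₂ s) ubDomain μ := by
  rcases Nat.eq_zero_or_pos s with rfl | hs
  · obtain ⟨i₁, hi₁⟩ := exists_pos_of_ne_zero hf₁ h₁
    obtain ⟨i₂, hi₂⟩ := exists_pos_of_ne_zero hf₂ h₂
    -- For `s = 0` the objective depends only on `μ.1 + μ.2`, so neither multiplier has its own
    -- barrier. This explicit point attains the lower bound from weak duality.
    have hμ : ((∑ i, f₁ i, ∑ i, f₂ i) : ℝ × ℝ) ∈ ubDomain :=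
      ⟨sum_pos' (fun i _ => hf₁ i) ⟨i₁, mem_univ _, hi₁⟩,
        sum_pos' (fun i _ => hf₂ i) ⟨i₂, mem_univ _, hi₂⟩⟩
    refine ⟨_, hμ, fun ν hν => ?_⟩
    obtain ⟨T, hT, h⟩ := exists_subsetObjective_eq f₁ f₂ 0 (∑ i, f₁ i, ∑ i, f₂ i)
    obtain rfl : T = Finset.univ := by
      rw [← card_eq_iff_eq_univ, hT, Fintype.card_fin, Nat.sub_zero]
    have hval : ubObjective f₁ f₂ 0 (∑ i, f₁ i, ∑ i, f₂ i) =
        ∑ i, (f₁ i + f₂ i) * Real.log ((f₁ i + f₂ i) / ∑ j, (f₁ j + f₂ j)) := by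
      rw [← h, subsetObjective, add_assoc, ← sum_add_distrib]
      simp only [Pi.sub_apply, add_sub_cancel, vVec, sum_sub_distrib, ← sum_add_distrib]
    have hle := ((coe_sum_le_phi hm hf₁ hf₂ 0).trans (phi_le_psi hf₁ hf₂ 0)).trans
      (iInf₂_le ν hν)
    rw [← hval, EReal.coe_le_coe_iff] at hle
    exact hle
  · exact exists_isMinOn_ubObjective_of_pos hf₁ hf₂ h₁ h₂ hs

lemma psi_eq_coe_of_isMinOn {s : ℕ} {μ : ℝ × ℝ} (hμ : μ ∈ ubDomain)
    (h : IsMinOn (ubObjective f₁ f₂ s) ubDomain μ) :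
    (ubObjective f₁ f₂ s μ : EReal) = psi f₁ f₂ s :=
  le_antisymm (le_iInf₂ fun _ hν => EReal.coe_le_coe_iff.2 (h hν)) (iInf₂_le μ hμ)

/-! ### Vanishing class sums -/

/-- The optimal value with unconstrained parameters is an upper bound for `psi`. -/
lemma psi_le_coe_sum (hf₁ : ∀ i, 0 ≤ f₁ i) (hf₂ : ∀ i, 0 ≤ f₂ i) (s : ℕ) :
    psi f₁ f₂ s ≤ ((∑ i, (f₁ i * Real.log (f₁ i / ∑ j, f₁ j) +
      f₂ i * Real.log (f₂ i / ∑ j, f₂ j)) : ℝ) : EReal) := by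
  set c := ∑ i, (f₁ i * Real.log (f₁ i / ∑ j, f₁ j) + f₂ i * Real.log (f₂ i / ∑ j, f₂ j)) with hc
  have key : ∀ f : Fin m → ℝ, (∀ i, 0 ≤ f i) → ∀ ε > 0, ∀ i,
      f i * Real.log (f i / (∑ j, f j + ε)) ≤ f i * Real.log (f i / ∑ j, f j) := by
    intro f hf ε hε i
    rcases (hf i).eq_or_lt with h | h
    · simp [← h]
    · have hF : 0 < ∑ j, f j := sum_pos' (fun i _ => hf i) ⟨i, mem_univ _, h⟩
      gcongr
      linarith
  have hle : ∀ ε > 0, psi f₁ f₂ s ≤ ((c + 2 * ε : ℝ) : EReal) := by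
    intro ε hε
    -- The shift by `ε` keeps the multipliers positive when a class sum is zero.
    have hμ : ((∑ i, f₁ i + ε, ∑ i, f₂ i + ε) : ℝ × ℝ) ∈ ubDomain :=
      ⟨add_pos_of_nonneg_of_pos (sum_nonneg fun i _ => hf₁ i) hε,
        add_pos_of_nonneg_of_pos (sum_nonneg fun i _ => hf₂ i) hε⟩
    refine (iInf₂_le _ hμ).trans (EReal.coe_le_coe_iff.2 ?_)
    obtain ⟨T, -, h⟩ := exists_subsetObjective_eq f₁ f₂ s (∑ i, f₁ i + ε, ∑ i, f₂ i + ε)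
    rw [← h, subsetObjective]
    have hz : ∑ i ∈ T, (vVec f₁ f₂ (∑ i, f₁ i + ε, ∑ i, f₂ i + ε) -
        wVec f₁ f₂ (∑ i, f₁ i + ε, ∑ i, f₂ i + ε)) i ≤ 0 :=
      sum_nonpos fun i _ => sub_nonpos.2 (vVec_le_wVec hf₁ hf₂ hμ i)
    have hw : ∑ i, wVec f₁ f₂ (∑ i, f₁ i + ε, ∑ i, f₂ i + ε) i ≤ c - ∑ i, (f₁ i + f₂ i) := by
      rw [hc, ← sum_sub_distrib]
      refine sum_le_sum fun i _ => ?_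
      rw [wVec]
      linarith [key f₁ hf₁ ε hε i, key f₂ hf₂ ε hε i]
    rw [sum_add_distrib] at hw
    simp only
    linarith
  have ht : Filter.Tendsto (fun ε : ℝ => ((c + 2 * ε : ℝ) : EReal)) (nhdsWithin 0 (Ioi 0))
      (nhds (c : EReal)) := by
    have : Continuous fun ε : ℝ => ((c + 2 * ε : ℝ) : EReal) :=
      continuous_coe_real_ereal.comp (by fun_prop)
    simpa using (this.tendsto 0).mono_left nhdsWithin_le_nhds
  exact ge_of_tendsto ht (Filter.eventually_of_mem self_mem_nhdsWithin hle)

lemma psi_le_phi_of_eq_zero (hm : 1 ≤ m) (hf₁ : ∀ i, 0 ≤ f₁ i) (hf₂ : ∀ i, 0 ≤ f₂ i)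
    (h : f₁ = 0 ∨ f₂ = 0) (s t : ℕ) : psi f₁ f₂ s ≤ phi f₁ f₂ t := by
  refine (psi_le_coe_sum hf₁ hf₂ s).trans (le_trans (le_of_eq ?_) (coe_sum_le_phi hm hf₁ hf₂ t))
  rcases h with rfl | rfl <;> simp

/-! ### First-order optimality -/

lemma eventually_lt_of_hasDerivAt_neg {g : ℝ → ℝ} {D : ℝ} (h : HasDerivAt g D 0) (hD : D < 0) :
    ∀ᶠ t in nhdsWithin 0 (Ioi 0), g t < g 0 := by
  have h₁ := (hasDerivAt_iff_tendsto_slope.1 h).eventually_lt_const hD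
  have h₂ : nhdsWithin (0 : ℝ) (Ioi 0) ≤ nhdsWithin 0 {0}ᶜ :=
    nhdsWithin_mono _ fun t (ht : 0 < t) => ht.ne'
  filter_upwards [h₂ h₁, self_mem_nhdsWithin] with t ht (ht0 : 0 < t)
  rw [slope_def_field, sub_zero] at ht
  have := (div_neg_iff.1 ht).resolve_left fun h => (h.2.trans ht0).false
  linarith [this.1]

lemma eventually_mem_ubDomain {μ : ℝ × ℝ} (hμ : μ ∈ ubDomain) (d : ℝ × ℝ) :
    ∀ᶠ t : ℝ in nhds 0, μ + t • d ∈ ubDomain := by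
  have hc : Continuous fun t : ℝ => μ + t • d := by fun_prop
  exact hc.continuousAt.preimage_mem_nhds (isOpen_ubDomain.mem_nhds (by simpa using hμ))

lemma hasDerivAt_subsetObjective (T : Finset (Fin m)) {μ : ℝ × ℝ} (hμ : μ ∈ ubDomain) (d : ℝ × ℝ) :
    HasDerivAt (fun t : ℝ => subsetObjective f₁ f₂ T (μ + t • d))
      (d.1 + d.2 - (∑ i ∈ Tᶜ, f₁ i) * (d.1 / μ.1) - (∑ i ∈ Tᶜ, f₂ i) * (d.2 / μ.2) -
        (∑ i ∈ T, (f₁ i + f₂ i)) * ((d.1 + d.2) / (μ.1 + μ.2))) 0 := by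
  have h₁ : HasDerivAt (fun t : ℝ => μ.1 + t * d.1) d.1 0 := by
    simpa using ((hasDerivAt_id (0 : ℝ)).mul_const d.1).const_add μ.1
  have h₂ : HasDerivAt (fun t : ℝ => μ.2 + t * d.2) d.2 0 := by
    simpa using ((hasDerivAt_id (0 : ℝ)).mul_const d.2).const_add μ.2
  have l₁ := h₁.log (by simpa using hμ.1.ne')
  have l₂ := h₂.log (by simpa using hμ.2.ne')
  have l₃ := (h₁.add h₂).log (by simpa using (add_pos hμ.1 hμ.2).ne')
  have h := ((((h₁.add h₂).add_const (subsetConst f₁ f₂ T)).sub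
    (l₁.const_mul (∑ i ∈ Tᶜ, f₁ i))).sub (l₂.const_mul (∑ i ∈ Tᶜ, f₂ i))).sub
      (l₃.const_mul (∑ i ∈ T, (f₁ i + f₂ i)))
  simp only [Pi.add_apply, zero_mul, add_zero] at h
  refine h.congr_of_eventuallyEq ?_
  filter_upwards [eventually_mem_ubDomain hμ d] with t ht
  rw [subsetObjective_eq T ht]
  simp

/-- First-order optimality: at a minimizer, a convex combination of the gradients of the active
subset objectives vanishes. -/
lemma exists_mem_convexHull_stationary {s : ℕ} {μ : ℝ × ℝ} (hμ : μ ∈ ubDomain)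
    (hmin : IsMinOn (ubObjective f₁ f₂ s) ubDomain μ) :
    ∃ l ∈ convexHull ℝ ((fun (T : Finset (Fin m)) (i : Fin m) => if i ∈ T then (1 : ℝ) else 0) ''
      {T | #T = m - s ∧ subsetObjective f₁ f₂ T μ = ubObjective f₁ f₂ s μ}),
      ∑ i, l i * (f₁ i / μ.1 - (f₁ i + f₂ i) / (μ.1 + μ.2)) = ∑ i, f₁ i / μ.1 - 1 ∧
      ∑ i, l i * (f₂ i / μ.2 - (f₁ i + f₂ i) / (μ.1 + μ.2)) = ∑ i, f₂ i / μ.2 - 1 := by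
  set p : Fin m → ℝ := fun i => f₁ i / μ.1 - (f₁ i + f₂ i) / (μ.1 + μ.2) with hp
  set q : Fin m → ℝ := fun i => f₂ i / μ.2 - (f₁ i + f₂ i) / (μ.1 + μ.2) with hq
  -- The gradient of `subsetObjective f₁ f₂ T` at `μ` is `L` of the indicator of `T` minus the point
  -- `(∑ i, f₁ i / μ.1 - 1, ∑ i, f₂ i / μ.2 - 1)`.
  set L : (Fin m → ℝ) →ₗ[ℝ] ℝ × ℝ :=
    (Fintype.linearCombination ℝ p).prod (Fintype.linearCombination ℝ q) with hL
  set A : Set (Finset (Fin m)) := {T | #T = m - s ∧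
    subsetObjective f₁ f₂ T μ = ubObjective f₁ f₂ s μ} with hA
  set C := convexHull ℝ ((fun (T : Finset (Fin m)) (i : Fin m) =>
    if i ∈ T then (1 : ℝ) else 0) '' A) with hC
  have hCc : IsCompact (L '' C) :=
    ((A.toFinite.image _).isCompact_convexHull ℝ).image L.continuous_of_finiteDimensional
  by_contra hno
  have hnot : ((∑ i, f₁ i / μ.1 - 1, ∑ i, f₂ i / μ.2 - 1) : ℝ × ℝ) ∉ L '' C := by
    rintro ⟨l, hl, hl'⟩
    have h := Prod.ext_iff.1 hl'
    simp only [hL, LinearMap.prod_apply, Function.prod_apply, Fintype.linearCombination_apply,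
      smul_eq_mul] at h
    exact hno ⟨l, hl, h.1, h.2⟩
  -- The negative of a separating functional is a descent direction for every active `T`, while
  -- inactive ones stay below the maximum by continuity. As there are finitely many `T`, a common
  -- small step contradicts minimality.
  obtain ⟨φ, u, hu, hCu⟩ := geometric_hahn_banach_point_closed
    ((convex_convexHull ℝ _).linear_image L) hCc.isClosed hnot
  have hφ : ∀ x y : ℝ, φ (x, y) = x * φ (1, 0) + y * φ (0, 1) := by
    intro x y
    have : ((x, y) : ℝ × ℝ) = x • (1, 0) + y • (0, 1) := by simp
    rw [this, map_add, map_smul, map_smul, smul_eq_mul, smul_eq_mul]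
  set d : ℝ × ℝ := (-φ (1, 0), -φ (0, 1)) with hd
  have hdec : ∀ T : Finset (Fin m), #T = m - s →
      ∀ᶠ t : ℝ in nhdsWithin 0 (Ioi 0),
        subsetObjective f₁ f₂ T (μ + t • d) < ubObjective f₁ f₂ s μ := by
    intro T hT
    have hder := hasDerivAt_subsetObjective (f₁ := f₁) (f₂ := f₂) T hμ d
    rcases (subsetObjective_le_ubObjective (f₁ := f₁) (f₂ := f₂) hT μ).lt_or_eq with hlt | heq
    · refine nhdsWithin_le_nhds (hder.continuousAt.eventually_lt_const ?_)
      simpa using hlt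
    · have hTC : (fun i => if i ∈ T then (1 : ℝ) else 0) ∈ C :=
        subset_convexHull ℝ _ (mem_image_of_mem _ ⟨hT, heq⟩)
      have hlt := hu.trans (hCu _ (mem_image_of_mem L hTC))
      simp only [hL, LinearMap.prod_apply, Function.prod_apply, Fintype.linearCombination_apply,
        smul_eq_mul, ite_mul, one_mul, zero_mul, sum_ite_mem, Finset.univ_inter] at hlt
      rw [hφ, hφ (∑ i ∈ T, p i)] at hlt
      have := eventually_lt_of_hasDerivAt_neg hder (by
        simp only [hp, hq, sum_sub_distrib, ← sum_div] at hlt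
        rw [← sum_add_sum_compl T f₁, ← sum_add_sum_compl T f₂] at hlt
        simp only [hd]
        simp only [div_eq_mul_inv] at hlt ⊢
        linarith)
      simpa [heq] using this
  have hall := (Filter.eventually_all (ι := {T : Finset (Fin m) // #T = m - s})).2
    fun T => hdec T.1 T.2
  obtain ⟨t, ht, htd⟩ :=
    (hall.and (nhdsWithin_le_nhds (eventually_mem_ubDomain hμ d))).exists
  obtain ⟨T, hT, h⟩ := exists_subsetObjective_eq f₁ f₂ s (μ + t • d)
  have h₁ := ht ⟨T, hT⟩
  have h₂ : ubObjective f₁ f₂ s μ ≤ ubObjective f₁ f₂ s (μ + t • d) := hmin htd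
  simp only [h] at h₁
  exact absurd h₁ h₂.not_gt

/-! ### Multipliers and recovery of a primal point -/

/-- Only unit and fractional entries contribute to the sum, each at most `1`, so at least `m - s -
k` entries equal `1`. -/
lemma card_ne_one_le {s : ℕ} {l : Fin m → ℝ} (hl : ∀ i, l i ∈ Icc (0 : ℝ) 1) {k : ℕ}
    (hsum : ∑ i, l i = ((m - s : ℕ) : ℝ)) (hk : #{i | 0 < l i ∧ l i < 1} ≤ k) :
    #{i | l i ≠ 1} ≤ s + k := by
  have h : ((m - s : ℕ) : ℝ) ≤ ((#{i | l i = 1} + #{i | 0 < l i ∧ l i < 1} : ℕ) : ℝ) := by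
    rw [← hsum, Nat.cast_add, natCast_card_filter, natCast_card_filter, ← sum_add_distrib]
    refine sum_le_sum fun i _ => ?_
    obtain ⟨h0, h1⟩ := hl i
    split_ifs with h₁ h₂ h₂
    · linarith
    · linarith
    · linarith
    · have : l i = 0 := by
        by_contra h
        exact h₂ ⟨h0.lt_of_ne' h, h1.lt_of_ne h₁⟩
      linarith
  have h' := Nat.cast_le.1 h
  have := card_filter_add_card_filter_not (s := (Finset.univ : Finset (Fin m))) (fun i => l i = 1)
  rw [card_univ, Fintype.card_fin] at this
  simp only [ne_eq]
  omega

/-- At a minimizer there are multipliers with at most `s + 4` entries different from `1`. -/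
lemma exists_multipliers {s : ℕ} {μ : ℝ × ℝ} (hμ : μ ∈ ubDomain)
    (hmin : IsMinOn (ubObjective f₁ f₂ s) ubDomain μ) :
    ∃ l : Fin m → ℝ, (∀ i, l i ∈ Icc (0 : ℝ) 1) ∧ #{i | l i ≠ 1} ≤ s + 4 ∧
      ∑ i, l i * (vVec f₁ f₂ μ - wVec f₁ f₂ μ) i =
        topSum (m - s) (vVec f₁ f₂ μ - wVec f₁ f₂ μ) ∧
      ∑ i, l i * (f₁ i / μ.1 - (f₁ i + f₂ i) / (μ.1 + μ.2)) = ∑ i, f₁ i / μ.1 - 1 ∧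
      ∑ i, l i * (f₂ i / μ.2 - (f₁ i + f₂ i) / (μ.1 + μ.2)) = ∑ i, f₂ i / μ.2 - 1 := by
  obtain ⟨x, hx, hx₁, hx₂⟩ := exists_mem_convexHull_stationary hμ hmin
  set z := vVec f₁ f₂ μ - wVec f₁ f₂ μ with hz
  have hconv : Convex ℝ {x : Fin m → ℝ | (∀ i, x i ∈ Icc (0 : ℝ) 1) ∧
      ∑ i, x i = ((m - s : ℕ) : ℝ) ∧ ∑ i, x i * z i = topSum (m - s) z} := by
    rintro x ⟨h₁, h₂, h₃⟩ y ⟨k₁, k₂, k₃⟩ a b ha hb hab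
    refine ⟨fun i => convex_Icc (0 : ℝ) 1 (h₁ i) (k₁ i) ha hb hab, ?_, ?_⟩
    · simp only [Pi.add_apply, Pi.smul_apply, smul_eq_mul, sum_add_distrib, ← mul_sum, h₂, k₂]
      rw [← add_mul, hab, one_mul]
    · simp only [Pi.add_apply, Pi.smul_apply, smul_eq_mul, add_mul, mul_assoc, sum_add_distrib,
        ← mul_sum, h₃, k₃]
      rw [← add_mul, hab, one_mul]
  obtain ⟨hx01, hxs, hxz⟩ := convexHull_min (by
    rintro _ ⟨T, ⟨hT, hTμ⟩, rfl⟩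
    refine ⟨fun i => ?_, ?_, ?_⟩
    · by_cases hi : i ∈ T <;> simp [hi]
    · simp [hT]
    · simp only [ite_mul, one_mul, zero_mul, sum_ite_mem, Finset.univ_inter]
      exact add_left_cancel hTμ) hconv hx
  -- Four scalar equations are preserved, which is the source of the shift by `4`.
  obtain ⟨l, hl01, hLl, hcard⟩ := exists_map_eq_card_fractional_le
    ((Fintype.linearCombination ℝ fun _ : Fin m => (1 : ℝ)).prod
      ((Fintype.linearCombination ℝ z).prod
        ((Fintype.linearCombination ℝ fun i => f₁ i / μ.1 - (f₁ i + f₂ i) / (μ.1 + μ.2)).prod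
          (Fintype.linearCombination ℝ fun i => f₂ i / μ.2 - (f₁ i + f₂ i) / (μ.1 + μ.2))))) hx01
  simp only [LinearMap.prod_apply, Function.prod_apply, Fintype.linearCombination_apply, smul_eq_mul,
    mul_one, Prod.mk.injEq] at hLl
  obtain ⟨e₁, e₂, e₃, e₄⟩ := hLl
  refine ⟨l, hl01, card_ne_one_le hl01 (e₁.trans hxs) (hcard.trans (by simp)), e₂.trans hxz,
    e₃.trans hx₁, e₄.trans hx₂⟩

lemma mul_log_convexCombo_ge {f A B l : ℝ} (hf : 0 ≤ f) (hA : f = 0 ∨ 0 < A) (hB : f = 0 ∨ 0 < B)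
    (hl : l ∈ Icc (0 : ℝ) 1) :
    l * (f * Real.log A) + (1 - l) * (f * Real.log B) ≤
      f * Real.log (l * A + (1 - l) * B) := by
  rcases hf.eq_or_lt with rfl | hf
  · simp
  · have h := strictConcaveOn_log_Ioi.concaveOn.2 (hA.resolve_left hf.ne')
      (hB.resolve_left hf.ne') hl.1 (sub_nonneg.2 hl.2) (add_sub_cancel l 1)
    have := mul_le_mul_of_nonneg_left h hf.le
    simp only [smul_eq_mul] at this
    linarith

lemma convexCombo_pos {A B l : ℝ} (hA : 0 < A) (hB : 0 < B) (hl : l ∈ Icc (0 : ℝ) 1) :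
    0 < l * A + (1 - l) * B :=
  convex_Ioi (0 : ℝ) hA hB hl.1 (sub_nonneg.2 hl.2) (add_sub_cancel l 1)

/-- A minimizer of the upper-bound problem yields a feasible point with `s + 4` differences whose
training objective is at least the minimum. -/
lemma ubObjective_le_phi_of_isMinOn (hf₁ : ∀ i, 0 ≤ f₁ i) (hf₂ : ∀ i, 0 ≤ f₂ i) {s : ℕ} {μ : ℝ × ℝ}
    (hμ : μ ∈ ubDomain) (hmin : IsMinOn (ubObjective f₁ f₂ s) ubDomain μ) :
    (ubObjective f₁ f₂ s μ : EReal) ≤ phi f₁ f₂ (s + 4) := by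
  obtain ⟨l, hl, hcard, hz, hst₁, hst₂⟩ := exists_multipliers hμ hmin
  have hM : 0 < μ.1 + μ.2 := add_pos hμ.1 hμ.2
  set A : Fin m → ℝ := fun i => (f₁ i + f₂ i) / (μ.1 + μ.2) with hA
  -- The weight `l i` mixes the shared optimum `A i` with the separate optimum for each class.
  set θ₁ : Fin m → ℝ := fun i => l i * A i + (1 - l i) * (f₁ i / μ.1) with hθ₁
  set θ₂ : Fin m → ℝ := fun i => l i * A i + (1 - l i) * (f₂ i / μ.2) with hθ₂
  have hA0 : ∀ i, 0 ≤ A i := fun i => div_nonneg (add_nonneg (hf₁ i) (hf₂ i)) hM.le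
  have hA₁ : ∀ i, f₁ i = 0 ∨ 0 < A i := fun i => (hf₁ i).eq_or_lt.imp Eq.symm fun h =>
    div_pos (by linarith [hf₂ i]) hM
  have hA₂ : ∀ i, f₂ i = 0 ∨ 0 < A i := fun i => (hf₂ i).eq_or_lt.imp Eq.symm fun h =>
    div_pos (by linarith [hf₁ i]) hM
  have hB₁ : ∀ i, f₁ i = 0 ∨ 0 < f₁ i / μ.1 := fun i => (hf₁ i).eq_or_lt.imp Eq.symm fun h =>
    div_pos h hμ.1
  have hB₂ : ∀ i, f₂ i = 0 ∨ 0 < f₂ i / μ.2 := fun i => (hf₂ i).eq_or_lt.imp Eq.symm fun h =>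
    div_pos h hμ.2
  have n₁ : ∀ i, 0 ≤ θ₁ i := fun i => add_nonneg (mul_nonneg (hl i).1 (hA0 i))
    (mul_nonneg (sub_nonneg.2 (hl i).2) (div_nonneg (hf₁ i) hμ.1.le))
  have n₂ : ∀ i, 0 ≤ θ₂ i := fun i => add_nonneg (mul_nonneg (hl i).1 (hA0 i))
    (mul_nonneg (sub_nonneg.2 (hl i).2) (div_nonneg (hf₂ i) hμ.2.le))
  have p₁ : ∀ i, f₁ i = 0 ∨ 0 < θ₁ i := fun i => by
    rcases hA₁ i with h | h
    · exact .inl h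
    · exact (hB₁ i).imp_right fun h' => convexCombo_pos h h' (hl i)
  have p₂ : ∀ i, f₂ i = 0 ∨ 0 < θ₂ i := fun i => by
    rcases hA₂ i with h | h
    · exact .inl h
    · exact (hB₂ i).imp_right fun h' => convexCombo_pos h h' (hl i)
  -- Stationarity in `μ.1` is exactly this normalization.
  have s₁ : ∑ i, θ₁ i = 1 := by
    have : ∑ i, θ₁ i = ∑ i, f₁ i / μ.1 - ∑ i, l i * (f₁ i / μ.1 - A i) := by
      rw [← sum_sub_distrib]
      exact sum_congr rfl fun i _ => by simp only [hθ₁]; ring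
    rw [this, hst₁]; ring
  have s₂ : ∑ i, θ₂ i = 1 := by
    have : ∑ i, θ₂ i = ∑ i, f₂ i / μ.2 - ∑ i, l i * (f₂ i / μ.2 - A i) := by
      rw [← sum_sub_distrib]
      exact sum_congr rfl fun i _ => by simp only [hθ₂]; ring
    rw [this, hst₂]; ring
  have hfeas : (θ₁, θ₂) ∈ feasible m (s + 4) := by
    refine mem_feasible_of_nonneg n₁ n₂ s₁ s₂ ((card_le_card fun i hi => ?_).trans hcard)
    simp only [Finset.mem_filter, Finset.mem_univ, true_and] at hi ⊢
    intro h
    exact hi (by simp [hθ₁, hθ₂, h])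
  refine le_iSup₂_of_le (θ₁, θ₂) hfeas ?_
  rw [mnbLoss_eq_coe hf₁ hf₂ n₁ n₂ p₁ p₂, EReal.coe_le_coe_iff, ubObjective, ← hz]
  -- This cancels the linear terms of the dual objective, leaving a coordinatewise comparison by
  -- concavity.
  have hmass : μ.1 + μ.2 = ∑ i, (f₁ i + f₂ i) := by
    calc μ.1 + μ.2 = ∑ i, (μ.1 * θ₁ i + μ.2 * θ₂ i) := by
          rw [sum_add_distrib, ← mul_sum, ← mul_sum, s₁, s₂, mul_one, mul_one]
      _ = _ := sum_congr rfl fun i _ => by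
          have e : (μ.1 + μ.2) * A i = f₁ i + f₂ i := mul_div_cancel₀ _ hM.ne'
          have e₁ : μ.1 * (f₁ i / μ.1) = f₁ i := mul_div_cancel₀ _ hμ.1.ne'
          have e₂ : μ.2 * (f₂ i / μ.2) = f₂ i := mul_div_cancel₀ _ hμ.2.ne'
          simp only [hθ₁, hθ₂]
          linear_combination l i * e + (1 - l i) * e₁ + (1 - l i) * e₂
  rw [hmass, ← sum_add_distrib, ← sum_add_distrib]
  refine sum_le_sum fun i _ => ?_
  have c₁ := mul_log_convexCombo_ge (hf₁ i) (hA₁ i) (hB₁ i) (hl i)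
  have c₂ := mul_log_convexCombo_ge (hf₂ i) (hA₂ i) (hB₂ i) (hl i)
  refine le_trans (le_of_eq ?_) (add_le_add c₁ c₂)
  simp only [Pi.sub_apply, vVec, wVec, hA]
  ring

theorem psi_le_phi_add_four (hm : 1 ≤ m) (hf₁ : ∀ i, 0 ≤ f₁ i) (hf₂ : ∀ i, 0 ≤ f₂ i) (s : ℕ) :
    psi f₁ f₂ s ≤ phi f₁ f₂ (s + 4) := by
  by_cases h : f₁ = 0 ∨ f₂ = 0
  · exact psi_le_phi_of_eq_zero hm hf₁ hf₂ h s _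
  · rw [not_or] at h
    obtain ⟨μ, hμ, hmin⟩ := exists_isMinOn_ubObjective hm hf₁ hf₂ h.1 h.2 s
    exact (psi_eq_coe_of_isMinOn hμ hmin).symm.trans_le
      (ubObjective_le_phi_of_isMinOn hf₁ hf₂ hμ hmin)

end

end SparseMNB

theorem theorem2 {n m : ℕ} (hm : 1 ≤ m) (X : Fin n → Fin m → ℝ) (hX : ∀ j i, 0 ≤ X j i)
    (Y : Fin n → Fin 2) (f₁ f₂ : Fin m → ℝ)
    (hf₁ : f₁ = SparseMNB.classSum X Y 0) (hf₂ : f₂ = SparseMNB.classSum X Y 1) :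
    -- the optimal value of the sparse training problem is attained
    (∀ s : ℕ, ∃ θ ∈ SparseMNB.feasible m s,
      SparseMNB.mnbLoss f₁ f₂ θ.1 θ.2 = SparseMNB.phi f₁ f₂ s) ∧
    -- the upper-bound problem is convex
    (∀ s : ℕ, ConvexOn ℝ SparseMNB.ubDomain (SparseMNB.ubObjective f₁ f₂ s)) ∧
    -- its minimum is attained, unless one of the two class sums vanishes
    (f₁ ≠ 0 → f₂ ≠ 0 → ∀ s : ℕ, ∃ μ ∈ SparseMNB.ubDomain,
      (SparseMNB.ubObjective f₁ f₂ s μ : EReal) = SparseMNB.psi f₁ f₂ s) ∧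
    -- it is an upper bound
    (∀ s : ℕ, SparseMNB.phi f₁ f₂ s ≤ SparseMNB.psi f₁ f₂ s) ∧
    -- the bound is tight up to a shift of 4 in the sparsity
    (∀ s : ℕ, 4 ≤ s →
      SparseMNB.psi f₁ f₂ (s - 4) ≤ SparseMNB.phi f₁ f₂ s ∧
      SparseMNB.phi f₁ f₂ s ≤ SparseMNB.psi f₁ f₂ s ∧
      SparseMNB.psi f₁ f₂ s ≤ SparseMNB.phi f₁ f₂ (s + 4)) := by
  have h₁ : ∀ i, 0 ≤ f₁ i := fun i => hf₁ ▸ SparseMNB.classSum_nonneg hX Y 0 i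
  have h₂ : ∀ i, 0 ≤ f₂ i := fun i => hf₂ ▸ SparseMNB.classSum_nonneg hX Y 1 i
  refine ⟨SparseMNB.exists_mnbLoss_eq_phi hm h₁ h₂, SparseMNB.convexOn_ubObjective h₁ h₂,
    fun n₁ n₂ s => ?_, SparseMNB.phi_le_psi h₁ h₂, fun s hs =>
      ⟨?_, SparseMNB.phi_le_psi h₁ h₂ s, SparseMNB.psi_le_phi_add_four hm h₁ h₂ s⟩⟩
  · obtain ⟨μ, hμ, hmin⟩ := SparseMNB.exists_isMinOn_ubObjective hm h₁ h₂ n₁ n₂ s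
    exact ⟨μ, hμ, SparseMNB.psi_eq_coe_of_isMinOn hμ hmin⟩
  · simpa only [Nat.sub_add_cancel hs] using SparseMNB.psi_le_phi_add_four hm h₁ h₂ (s - 4)
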